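/- Let $\Theta\subseteq\mathbb R^d$ be open, connected and non-empty, and let $\psi:\Theta\to\mathbb R^n$ be a locally isometric embedding, i.e. a smooth topological embedding whose differential preserves inner products at every point. Let $\mathcal M=\psi(\Theta)$ with the induced (flat) Riemannian metric and Riemannian volume $\mathrm{vol}$, and let $\theta^i=x^i\circ\psi^{-1}:\mathcal M\to\mathbb R$, $i=1,\dots,d$, be the isometric coordinates. Let $\mu$ be a probability measure on $\mathcal M$ with an everywhere positive density with respect to $\mathrm{vol}$. For $p\in\mathcal M$ let $\mathrm{Hess}_f(p)$ be the Hessian at $p$ of a function $f$ on $\mathcal M$ in tangent coordinates, i.e. the second derivative at $p$ of $f\circ\pi_p^{-1}$, where $\pi_p$ is the orthogonal projection of a neighbourhood of $p$ in $\mathcal M$ to the affine tangent space $T_p\mathcal M\subset\mathbb R^n$; if $f$ has only weak derivatives up to order two, $f$ is replaced here by its second-order jet at $p$ (this defines $\mathrm{Hess}_f(p)$ for almost every $p$). Let $\nu$ be either $\mathrm{vol}$ or $\mu$, and let $W^{2,2}(\mathcal M)$ be the space of (classes of) functions in $L^2(\nu)$ that have weak derivatives up to order two and whose gradient and Hessian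 have norms in $L^2(\nu)$. Put $$\mathcal H^{\mathcal M}(f)=\int_{\mathcal M}\|\mathrm{Hess}_f(p)\|_F^2\,d\mu(p)\in[0,\infty],\qquad \ker\mathcal H^{\mathcal M}=\{f\in W^{2,2}(\mathcal M):\mathcal H^{\mathcal M}(f)=0\}.$$ Then: 1. A function $f\in W^{2,2}(\mathcal M)$ satisfies $\mathcal H^{\mathcal M}(f)=0$ if and only if there are $a,b_1,\dots,b_d\in\mathbb R$ with $f=a+\sum_i b_i\theta^i$ almost everywhere. 2. If the constants and the coordinates $\theta^i$ are square integrable, i.e. $\int_{\mathcal M}(1+\sum_i(\theta^i)^2)\,d\nu<\infty$ (for example if $\Theta$ is bounded), then $\ker\mathcal H^{\mathcal M}$ is a linear subspace of dimension $d+1$, spanned by the constant function $1$ and the isometric coordinates $\theta^1,\dots,\theta^d$. -/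

import Mathlib

open MeasureTheory Topology Filter
open scoped ENNReal ContDiff

noncomputable section

namespace HessianForm

/-- Euclidean space `ℝ^k`. -/
abbrev E (k : ℕ) := EuclideanSpace ℝ (Fin k)

variable {d n : ℕ}

/-- The `i`-th standard basis vector of `ℝ^k`. -/
def stdVec {k : ℕ} (i : Fin k) : E k := EuclideanSpace.single i (1 : ℝ)

/-! ### The manifold `M = ψ(Θ)` -/

/-- `ψ : Θ → ℝ^n` is a locally isometric embedding: a smooth map which is a homeomorphism onto its
image and whose differential preserves inner products. -/
structure IsLocallyIsometricEmbedding (Θ : Set (E d)) (ψ : E d → E n) : Prop where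
  contDiffOn : ContDiffOn ℝ ∞ ψ Θ
  isEmbedding : IsEmbedding (Θ.domRestrict ψ)
  inner_fderiv : ∀ x ∈ Θ, ∀ v w : E d,
    inner ℝ (fderiv ℝ ψ x v) (fderiv ℝ ψ x w) = inner ℝ v w

/-- The isometric coordinates `θ = ψ⁻¹ : M → Θ`; the `i`-th one is `p ↦ isoCoord Θ ψ p i`. -/
def isoCoord (Θ : Set (E d)) (ψ : E d → E n) : E n → E d := Function.invFunOn ψ Θ

/-- The matrix `g_ij = ⟨∂_i ψ, ∂_j ψ⟩` of the metric induced on `M` by `ℝ^n`, in the coordinates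
given by `ψ`. -/
def gramMatrix (ψ : E d → E n) (x : E d) : Matrix (Fin d) (Fin d) ℝ :=
  Matrix.of fun i j => inner ℝ (fderiv ℝ ψ x (stdVec i)) (fderiv ℝ ψ x (stdVec j))

/-- The Riemannian volume measure `√(det g) dx` of `M = ψ(Θ)`, as a measure on `ℝ^n` carried
by `M`. -/
def riemVolume (Θ : Set (E d)) (ψ : E d → E n) : Measure (E n) :=
  ((volume.restrict Θ).withDensity fun x => ENNReal.ofReal √(gramMatrix ψ x).det).map ψ

/-! ### Tangent coordinates -/

/-- The tangent space `T_p M`, as a linear subspace of `ℝ^n`. -/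
def tangentSubspace (Θ : Set (E d)) (ψ : E d → E n) (p : E n) : Submodule ℝ (E n) :=
  LinearMap.range (fderiv ℝ ψ (isoCoord Θ ψ p)).toLinearMap

/-- The orthogonal projection `π_p` onto the affine tangent space at `p`, which is identified with
the vector space `T_p M` by taking `p` as the origin. -/
def tangentProj (Θ : Set (E d)) (ψ : E d → E n) (p q : E n) : tangentSubspace Θ ψ p :=
  (tangentSubspace Θ ψ p).orthogonalProjectionOnto (q - p)

/-- `s` is, near the origin of `T_p M`, the inverse of the projection `π_p : U_p → T_p M` of a
neighbourhood `U_p` of `p` in `M`. This determines the germ of `s` at the origin. -/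
structure IsTangentParam (Θ : Set (E d)) (ψ : E d → E n) (p : E n)
    (s : tangentSubspace Θ ψ p → E n) : Prop where
  map_zero : s 0 = p
  continuousAt : ContinuousAt s 0
  eventually_mem : ∀ᶠ v in 𝓝 0, s v ∈ ψ '' Θ
  eventually_proj : ∀ᶠ v in 𝓝 0, tangentProj Θ ψ p (s v) = v

open Classical in
/-- The inverse `π_p⁻¹` of the tangent coordinates around `p`. -/
def tangentParam (Θ : Set (E d)) (ψ : E d → E n) (p : E n) : tangentSubspace Θ ψ p → E n :=
  if h : ∃ s, IsTangentParam Θ ψ p s then h.choose else fun _ => p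

/-- The differential at `p` of a function `f` on `M`, in tangent coordinates. -/
def tanDeriv (Θ : Set (E d)) (ψ : E d → E n) (f : E n → ℝ) (p : E n) :
    tangentSubspace Θ ψ p →L[ℝ] ℝ :=
  fderiv ℝ (f ∘ tangentParam Θ ψ p) 0

/-- The Hessian `Hess_f^tan(p)` of a (twice differentiable) function `f` on `M`: the second
derivative, at the origin, of `f` written in the tangent coordinates around `p`. -/
def tanHess (Θ : Set (E d)) (ψ : E d → E n) (f : E n → ℝ) (p : E n) :
    tangentSubspace Θ ψ p →L[ℝ] tangentSubspace Θ ψ p →L[ℝ] ℝ :=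
  fderiv ℝ (fderiv ℝ (f ∘ tangentParam Θ ψ p)) 0

/-- The squared Frobenius norm of a bilinear form on a Euclidean space: the sum of the squares of
its entries in an orthonormal basis. -/
def frobSq {V : Type*} [NormedAddCommGroup V] [InnerProductSpace ℝ V] [FiniteDimensional ℝ V]
    (B : V →L[ℝ] V →L[ℝ] ℝ) : ℝ :=
  ∑ a, ∑ b, (B (stdOrthonormalBasis ℝ V a) (stdOrthonormalBasis ℝ V b)) ^ 2

/-! ### Weak derivatives -/

/-- `v` is the weak partial derivative `∂_i u` on the open set `Θ`. -/
structure IsWeakPartial (Θ : Set (E d)) (i : Fin d) (u v : E d → ℝ) : Prop where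
  locallyIntegrableOn : LocallyIntegrableOn u Θ
  locallyIntegrableOn_deriv : LocallyIntegrableOn v Θ
  integral_eq : ∀ φ : E d → ℝ, ContDiff ℝ ∞ φ → HasCompactSupport φ → tsupport φ ⊆ Θ →
    ∫ x in Θ, u x * fderiv ℝ φ x (stdVec i) = -∫ x in Θ, v x * φ x

/-- `u` has a weak partial derivative `∂_i u` on `Θ`. -/
def HasWeakPartial (Θ : Set (E d)) (i : Fin d) (u : E d → ℝ) : Prop :=
  ∃ v, IsWeakPartial Θ i u v

open Classical in
/-- The weak partial derivative `∂_i u` on `Θ` (unique almost everywhere on `Θ`); zero if there is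
none. -/
def weakPartial (Θ : Set (E d)) (i : Fin d) (u : E d → ℝ) : E d → ℝ :=
  if h : HasWeakPartial Θ i u then h.choose else 0

/-- The second-order jet at `p ∈ M` of a function `f` on `M` with weak derivatives up to order two:
the polynomial of degree two in the isometric coordinates with the same value and the same (weak)
derivatives of order one and two at `p` as `f`. -/
def jet (Θ : Set (E d)) (ψ : E d → E n) (f : E n → ℝ) (p q : E n) : ℝ :=
  f p
    + ∑ i, weakPartial Θ i (f ∘ ψ) (isoCoord Θ ψ p) * (isoCoord Θ ψ q i - isoCoord Θ ψ p i)
    + 1 / 2 * ∑ i, ∑ j, weakPartial Θ j (weakPartial Θ i (f ∘ ψ)) (isoCoord Θ ψ p)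
        * (isoCoord Θ ψ q i - isoCoord Θ ψ p i) * (isoCoord Θ ψ q j - isoCoord Θ ψ p j)

/-- The differential of a weakly differentiable function `f` on `M` at (almost every) `p`. The
differential at `p` depends only on the jet of `f` at `p`. -/
def weakTanDeriv (Θ : Set (E d)) (ψ : E d → E n) (f : E n → ℝ) (p : E n) :
    tangentSubspace Θ ψ p →L[ℝ] ℝ :=
  tanDeriv Θ ψ (jet Θ ψ f p) p

/-- The Hessian `Hess_f^tan(p)` of a twice weakly differentiable function `f` on `M` at (almost
every) `p`. The Hessian at `p` depends only on the second-order jet of `f` at `p`. -/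
def weakTanHess (Θ : Set (E d)) (ψ : E d → E n) (f : E n → ℝ) (p : E n) :
    tangentSubspace Θ ψ p →L[ℝ] tangentSubspace Θ ψ p →L[ℝ] ℝ :=
  tanHess Θ ψ (jet Θ ψ f p) p

/-! ### The Sobolev space and the quadratic form -/

/-- The Sobolev space `W^{2,2}(M)`: the functions in `L²` with weak derivatives up to order two
whose gradient and Hessian are in `L²`. Square integrability refers to the measure `ν` on `M`. -/
def W22 (Θ : Set (E d)) (ψ : E d → E n) (ν : Measure (E n)) : Set (Lp ℝ 2 ν) :=
  {f | (∀ i, HasWeakPartial Θ i (f ∘ ψ)) ∧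
    (∀ i j, HasWeakPartial Θ j (weakPartial Θ i (f ∘ ψ))) ∧
    ∫⁻ p, ENNReal.ofReal (‖weakTanDeriv Θ ψ f p‖ ^ 2) ∂ν < ⊤ ∧
    ∫⁻ p, ENNReal.ofReal (frobSq (weakTanHess Θ ψ f p)) ∂ν < ⊤}

/-- The form `H^M(f) = ∫_M ‖Hess_f^tan(p)‖_F² dμ(p)`, with values in `[0, ∞]`. -/
def hessForm (Θ : Set (E d)) (ψ : E d → E n) (μ : Measure (E n)) (f : E n → ℝ) : ℝ≥0∞ :=
  ∫⁻ p, ENNReal.ofReal (frobSq (weakTanHess Θ ψ f p)) ∂μ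

/-- The null space of `H^M` on `W^{2,2}(M)`. -/
def nullSpace (Θ : Set (E d)) (ψ : E d → E n) (ν μ : Measure (E n)) : Set (Lp ℝ 2 ν) :=
  {f | f ∈ W22 Θ ψ ν ∧ hessForm Θ ψ μ f = 0}

end HessianForm

end

/-!
Differentiating `⟨∂_v ψ, ∂_w ψ⟩ = ⟨v, w⟩` shows that the second derivative of `ψ` is normal to `M`.
Hence the change from isometric to tangent coordinates around `p` has vanishing second derivative at
`p`, and the tangent Hessian of a function on `M` is the flat Hessian of its pullback to `Θ`. So the
form vanishes exactly when all second weak derivatives of the pullback vanish. By mollification, a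
function with vanishing weak gradient on a connected open set is constant; applied first to the weak
partial derivatives and then to the pullback minus its linear part, this makes the pullback affine.
In isometric coordinates the Riemannian volume is Lebesgue measure, and an affine function that
vanishes almost everywhere on the open set `Θ` is zero, which gives the linear independence of `1,
θ^1, …, θ^d`.
-/

open scoped Convolution

namespace HessianForm

/-! ### Second derivatives -/

section SecondDerivatives

variable {V W Z : Type*} [NormedAddCommGroup V] [NormedSpace ℝ V] [NormedAddCommGroup W]
  [NormedSpace ℝ W] [NormedAddCommGroup Z] [NormedSpace ℝ Z]

theorem eventually_differentiableAt {f : V → W} {x : V} (hf : ContDiffAt ℝ 2 f x) :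
    ∀ᶠ y in 𝓝 x, DifferentiableAt ℝ f y :=
  (hf.eventually (by simp)).mono fun _ h => h.differentiableAt two_ne_zero

theorem hasFDerivAt_fderiv {f : V → W} {x : V} (hf : ContDiffAt ℝ 2 f x) :
    HasFDerivAt (fderiv ℝ f) (fderiv ℝ (fderiv ℝ f) x) x :=
  ((hf.fderiv_right (m := 1) le_rfl).differentiableAt one_ne_zero).hasFDerivAt

theorem fderiv_fderiv_apply_comm {f : V → W} {x : V} (hf : ContDiffAt ℝ 2 f x) (a b : V) :
    fderiv ℝ (fderiv ℝ f) x a b = fderiv ℝ (fderiv ℝ f) x b a :=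
  (hf.isSymmSndFDerivAt (by rw [minSmoothness_of_isRCLikeNormedField])).eq a b

theorem fderiv_fderiv_apply_eq {f : V → W} {x : V} (hf : ContDiffAt ℝ 2 f x) (a b : V) :
    fderiv ℝ (fun y => fderiv ℝ f y b) x a = fderiv ℝ (fderiv ℝ f) x a b := by
  simp [fderiv_clm_apply (hasFDerivAt_fderiv hf).differentiableAt (differentiableAt_const b)]

theorem fderiv_fderiv_comp_apply {g : W → Z} {f : V → W} {x : V} (hg : ContDiffAt ℝ 2 g (f x))
    (hf : ContDiffAt ℝ 2 f x) (u v : V) :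
    fderiv ℝ (fderiv ℝ (g ∘ f)) x u v
      = fderiv ℝ (fderiv ℝ g) (f x) (fderiv ℝ f x u) (fderiv ℝ f x v)
        + fderiv ℝ g (f x) (fderiv ℝ (fderiv ℝ f) x u v) := by
  have hchain : fderiv ℝ (g ∘ f) =ᶠ[𝓝 x] fun y => (fderiv ℝ g (f y)).comp (fderiv ℝ f y) := by
    filter_upwards [hf.continuousAt.eventually (eventually_differentiableAt hg),
      eventually_differentiableAt hf] with y hgy hfy using fderiv_comp y hgy hfy
  have hderiv := ((hasFDerivAt_fderiv hg).comp x
    (hf.differentiableAt two_ne_zero).hasFDerivAt).clm_comp (hasFDerivAt_fderiv hf)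
  have hD : fderiv ℝ (fun y => (fderiv ℝ g (f y)).comp (fderiv ℝ f y)) x = _ := hderiv.fderiv
  rw [hchain.fderiv_eq, hD]
  simp [add_comm]

theorem contDiffAt_of_eventually_rightInverse [CompleteSpace V] {k : WithTop ℕ∞} (hk : k ≠ 0)
    {G : V → W} {y : W → V} {w : W} {L : V ≃L[ℝ] W} (hG : ContDiffAt ℝ k G (y w))
    (hL : HasFDerivAt G (L : V →L[ℝ] W) (y w)) (hy : ContinuousAt y w)
    (hGy : ∀ᶠ v in 𝓝 w, G (y v) = v) : ContDiffAt ℝ k y w := by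
  have hinv := hG.to_localInverse hL hk
  rw [hGy.self_of_nhds] at hinv
  refine hinv.congr_of_eventuallyEq ?_
  filter_upwards [hGy, hy.eventually (hG.hasStrictFDerivAt' hL hk).eventually_left_inverse]
    with v hv hleft
  rw [hv] at hleft
  exact hleft.symm

theorem fderiv_fderiv_eq_zero_of_rightInverse {G : V → W} {y : W → V} {w : W}
    (hG : ContDiffAt ℝ 2 G (y w)) (hy : ContDiffAt ℝ 2 y w) (hGy : ∀ᶠ v in 𝓝 w, G (y v) = v)
    (hinj : Function.Injective (fderiv ℝ G (y w))) (hG₂ : fderiv ℝ (fderiv ℝ G) (y w) = 0) :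
    fderiv ℝ (fderiv ℝ y) w = 0 := by
  have hid : G ∘ y =ᶠ[𝓝 w] id := hGy
  have hzero : fderiv ℝ (fderiv ℝ (G ∘ y)) w = 0 := by
    rw [hid.fderiv.fderiv_eq, show fderiv ℝ id = fun _ : W => ContinuousLinearMap.id ℝ W from
      funext fun _ => fderiv_id, fderiv_fun_const, Pi.zero_apply]
  ext u v
  refine hinj ?_
  simpa [hzero, hG₂] using (fderiv_fderiv_comp_apply hG hy u v).symm

/-- The polynomial of degree two with value `c`, differential `ℓ` and (for symmetric `B`) second
derivative `B` at `x₀`. It is the coordinate form of a second-order jet. -/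
noncomputable def quadratic (c : ℝ) (ℓ : V →L[ℝ] ℝ) (B : V →L[ℝ] V →L[ℝ] ℝ) (x₀ x : V) : ℝ :=
  c + ℓ (x - x₀) + 1 / 2 * B (x - x₀) (x - x₀)

variable (c : ℝ) (ℓ : V →L[ℝ] ℝ) (B : V →L[ℝ] V →L[ℝ] ℝ) (x₀ x : V)

theorem contDiff_quadratic : ContDiff ℝ 2 (quadratic c ℓ B x₀) := by
  unfold quadratic
  fun_prop

theorem fderiv_quadratic : fderiv ℝ (quadratic c ℓ B x₀) x
    = ℓ + (1 / 2 : ℝ) • (B + B.flip) (x - x₀) := by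
  have hsub : HasFDerivAt (fun x => x - x₀) (ContinuousLinearMap.id ℝ V) x :=
    (hasFDerivAt_id x).sub_const x₀
  have h : HasFDerivAt (quadratic c ℓ B x₀) _ x :=
    ((ℓ.hasFDerivAt.comp x hsub).const_add c).add
      (((B.hasFDerivAt.comp x hsub).clm_apply hsub).const_mul (1 / 2))
  rw [h.fderiv]
  ext v
  simp

theorem fderiv_fderiv_quadratic_apply (u v : V) :
    fderiv ℝ (fderiv ℝ (quadratic c ℓ B x₀)) x u v = 1 / 2 * (B u v + B v u) := by
  have hfun : fderiv ℝ (quadratic c ℓ B x₀) = fun x => ℓ + (1 / 2 : ℝ) • (B + B.flip) (x - x₀) :=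
    funext (fderiv_quadratic c ℓ B x₀)
  have h : HasFDerivAt (fun x => ℓ + (1 / 2 : ℝ) • (B + B.flip) (x - x₀)) _ x :=
    (((B + B.flip).hasFDerivAt.comp x ((hasFDerivAt_id x).sub_const x₀)).const_smul
      (1 / 2 : ℝ)).const_add ℓ
  rw [hfun, h.fderiv]
  rfl

end SecondDerivatives

/-! ### Weak derivatives -/

section WeakDerivatives

variable {d : ℕ} {Θ U : Set (E d)} {i j : Fin d} {u v u' v' φ : E d → ℝ}

/-- A test function on `Θ`: a smooth function on the whole space with compact support in `Θ`. It is
what weak derivatives are tested against. -/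
structure IsTestFunction (Θ : Set (E d)) (φ : E d → ℝ) : Prop where
  contDiff : ContDiff ℝ ∞ φ
  hasCompactSupport : HasCompactSupport φ
  tsupport_subset : tsupport φ ⊆ Θ

theorem IsTestFunction.mono (hφ : IsTestFunction U φ) (hU : U ⊆ Θ) : IsTestFunction Θ φ where
  __ := hφ
  tsupport_subset := hφ.tsupport_subset.trans hU

theorem contDiff_fderiv_apply (hφ : ContDiff ℝ ∞ φ) (w : E d) :
    ContDiff ℝ ∞ fun x => fderiv ℝ φ x w :=
  (hφ.fderiv_right (m := ∞) (by simp)).clm_apply contDiff_const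

theorem IsTestFunction.fderiv_apply (hφ : IsTestFunction Θ φ) (w : E d) :
    IsTestFunction Θ fun x => fderiv ℝ φ x w where
  contDiff := contDiff_fderiv_apply hφ.contDiff w
  hasCompactSupport := hφ.hasCompactSupport.fderiv_apply ℝ w
  tsupport_subset := (tsupport_fderiv_apply_subset ℝ w).trans hφ.tsupport_subset

theorem IsTestFunction.integrable_mul (hφ : IsTestFunction Θ φ) (hu : LocallyIntegrableOn u Θ) :
    Integrable fun x => u x * φ x := by
  have hint : IntegrableOn (fun x => u x * φ x) (tsupport φ) :=
    (hu.integrableOn_compact_subset hφ.tsupport_subset hφ.hasCompactSupport).mul_continuousOn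
      hφ.contDiff.continuous.continuousOn hφ.hasCompactSupport
  exact (integrableOn_iff_integrable_of_support_subset
    ((Function.support_mul_subset_right u φ).trans (subset_tsupport φ))).1 hint

theorem IsTestFunction.setIntegral_mul (hφ : IsTestFunction Θ φ) :
    ∫ x in Θ, u x * φ x = ∫ x, u x * φ x :=
  setIntegral_eq_integral_of_forall_compl_eq_zero fun x hx => by
    rw [image_eq_zero_of_notMem_tsupport fun h => hx (hφ.tsupport_subset h), mul_zero]

theorem isWeakPartial_iff : IsWeakPartial Θ i u v ↔
    LocallyIntegrableOn u Θ ∧ LocallyIntegrableOn v Θ ∧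
      ∀ φ, IsTestFunction Θ φ → ∫ x, u x * fderiv ℝ φ x (stdVec i) = -∫ x, v x * φ x := by
  refine ⟨fun h => ⟨h.1, h.2, fun φ hφ => ?_⟩, fun ⟨hu, hv, h⟩ => ⟨hu, hv, fun φ h₁ h₂ h₃ => ?_⟩⟩
  · rw [← (hφ.fderiv_apply _).setIntegral_mul, ← hφ.setIntegral_mul]
    exact h.integral_eq φ hφ.1 hφ.2 hφ.3
  · have hφ : IsTestFunction Θ φ := ⟨h₁, h₂, h₃⟩
    rw [(hφ.fderiv_apply _).setIntegral_mul, hφ.setIntegral_mul, h φ hφ]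

theorem IsWeakPartial.integral_mul_fderiv (h : IsWeakPartial Θ i u v) (hφ : IsTestFunction Θ φ) :
    ∫ x, u x * fderiv ℝ φ x (stdVec i) = -∫ x, v x * φ x :=
  (isWeakPartial_iff.1 h).2.2 φ hφ

theorem IsWeakPartial.mono (h : IsWeakPartial Θ i u v) (hU : U ⊆ Θ) : IsWeakPartial U i u v :=
  isWeakPartial_iff.2 ⟨h.1.mono_set hU, h.2.mono_set hU,
    fun _ hφ => h.integral_mul_fderiv (hφ.mono hU)⟩

theorem IsWeakPartial.congr (h : IsWeakPartial Θ i u v) (hu : u =ᵐ[volume.restrict Θ] u')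
    (hv : v =ᵐ[volume.restrict Θ] v') : IsWeakPartial Θ i u' v' where
  locallyIntegrableOn := h.locallyIntegrableOn.congr hu
  locallyIntegrableOn_deriv := h.locallyIntegrableOn_deriv.congr hv
  integral_eq φ h₁ h₂ h₃ := by
    have hu' := integral_congr_ae (hu.mul (ae_eq_refl fun x => fderiv ℝ φ x (stdVec i)))
    have hv' := integral_congr_ae (hv.mul (ae_eq_refl φ))
    exact hu'.symm.trans ((h.integral_eq φ h₁ h₂ h₃).trans (congrArg Neg.neg hv'))

theorem IsWeakPartial.sub (h : IsWeakPartial Θ i u v) (h' : IsWeakPartial Θ i u' v') :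
    IsWeakPartial Θ i (fun x => u x - u' x) (fun x => v x - v' x) := by
  refine isWeakPartial_iff.2 ⟨h.1.sub h'.1, h.2.sub h'.2, fun φ hφ => ?_⟩
  have hφ' := hφ.fderiv_apply (stdVec i)
  simp only [sub_mul]
  rw [integral_sub (hφ'.integrable_mul h.1) (hφ'.integrable_mul h'.1),
    integral_sub (hφ.integrable_mul h.2) (hφ.integrable_mul h'.2),
    h.integral_mul_fderiv hφ, h'.integral_mul_fderiv hφ]
  ring

theorem ae_eq_of_integral_mul_eq (hΘ : IsOpen Θ) (hu : LocallyIntegrableOn u Θ)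
    (hv : LocallyIntegrableOn v Θ)
    (h : ∀ φ, IsTestFunction Θ φ → ∫ x, u x * φ x = ∫ x, v x * φ x) :
    u =ᵐ[volume.restrict Θ] v := by
  have hzero := hΘ.ae_eq_zero_of_integral_contDiff_smul_eq_zero (μ := volume) (hu.sub hv)
    fun φ h₁ h₂ h₃ => by
      have hφ : IsTestFunction Θ φ := ⟨h₁, h₂, h₃⟩
      simp only [Pi.sub_apply, smul_eq_mul, mul_comm (φ _), sub_mul]
      rw [integral_sub (hφ.integrable_mul hu) (hφ.integrable_mul hv), h _ hφ, sub_self]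
  rw [EventuallyEq, ae_restrict_iff' hΘ.measurableSet]
  filter_upwards [hzero] with x hx hxΘ
  exact sub_eq_zero.1 (hx hxΘ)

theorem IsWeakPartial.ae_unique (hΘ : IsOpen Θ) (h : IsWeakPartial Θ i u v)
    (h' : IsWeakPartial Θ i u v') : v =ᵐ[volume.restrict Θ] v' :=
  ae_eq_of_integral_mul_eq hΘ h.2 h'.2 fun _ hφ =>
    neg_injective ((h.integral_mul_fderiv hφ).symm.trans (h'.integral_mul_fderiv hφ))

theorem HasWeakPartial.isWeakPartial (h : HasWeakPartial Θ i u) :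
    IsWeakPartial Θ i u (weakPartial Θ i u) := by
  rw [weakPartial, dif_pos h]
  exact h.choose_spec

theorem IsWeakPartial.weakPartial_ae_eq (hΘ : IsOpen Θ) (h : IsWeakPartial Θ i u v) :
    weakPartial Θ i u =ᵐ[volume.restrict Θ] v :=
  (HasWeakPartial.isWeakPartial ⟨v, h⟩).ae_unique hΘ h

theorem IsWeakPartial.ae_eq_swap (hΘ : IsOpen Θ) {uᵢ uⱼ uᵢⱼ uⱼᵢ : E d → ℝ}
    (hᵢ : IsWeakPartial Θ i u uᵢ) (hⱼ : IsWeakPartial Θ j u uⱼ) (hᵢⱼ : IsWeakPartial Θ j uᵢ uᵢⱼ)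
    (hⱼᵢ : IsWeakPartial Θ i uⱼ uⱼᵢ) : uᵢⱼ =ᵐ[volume.restrict Θ] uⱼᵢ := by
  refine ae_eq_of_integral_mul_eq hΘ hᵢⱼ.2 hⱼᵢ.2 fun φ hφ => ?_
  have hφ₂ (x : E d) : ContDiffAt ℝ 2 φ x := hφ.contDiff.contDiffAt.of_le (by norm_cast)
  have hcomm (x : E d) : fderiv ℝ (fun y => fderiv ℝ φ y (stdVec j)) x (stdVec i)
      = fderiv ℝ (fun y => fderiv ℝ φ y (stdVec i)) x (stdVec j) := by
    rw [fderiv_fderiv_apply_eq (hφ₂ x), fderiv_fderiv_apply_eq (hφ₂ x),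
      fderiv_fderiv_apply_comm (hφ₂ x)]
  calc ∫ x, uᵢⱼ x * φ x
      = ∫ x, u x * fderiv ℝ (fun y => fderiv ℝ φ y (stdVec j)) x (stdVec i) := by
        rw [hᵢ.integral_mul_fderiv (hφ.fderiv_apply _), hᵢⱼ.integral_mul_fderiv hφ, neg_neg]
    _ = ∫ x, u x * fderiv ℝ (fun y => fderiv ℝ φ y (stdVec i)) x (stdVec j) := by
        simp only [hcomm]
    _ = ∫ x, uⱼᵢ x * φ x := by
        rw [hⱼ.integral_mul_fderiv (hφ.fderiv_apply _), hⱼᵢ.integral_mul_fderiv hφ, neg_neg]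

theorem isWeakPartial_of_contDiff (hu : ContDiff ℝ ∞ u) :
    IsWeakPartial Θ i u fun x => fderiv ℝ u x (stdVec i) := by
  have hu' := contDiff_fderiv_apply hu (stdVec i)
  have hl : LocallyIntegrableOn u Θ := hu.continuous.locallyIntegrable.locallyIntegrableOn Θ
  have hl' := hu'.continuous.locallyIntegrable.locallyIntegrableOn (μ := volume) Θ
  exact isWeakPartial_iff.2 ⟨hl, hl', fun φ hφ =>
    integral_mul_fderiv_eq_neg_fderiv_mul_of_integrable (hφ.integrable_mul hl')
      ((hφ.fderiv_apply _).integrable_mul hl) (hφ.integrable_mul hl)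
      (fun x _ => hu.differentiable (by simp) x)
      (fun x _ => hφ.contDiff.differentiable (by simp) x)⟩

theorem isWeakPartial_const (c : ℝ) : IsWeakPartial Θ i (fun _ => c) fun _ => 0 := by
  simpa using isWeakPartial_of_contDiff (Θ := Θ) (i := i) (contDiff_const (c := c))

/-! ### Functions with vanishing weak derivatives -/

theorem IsTestFunction.comp_const_sub {x : E d} (hφ : ContDiff ℝ ∞ φ) (hc : HasCompactSupport φ)
    (hx : ∀ y, x - y ∈ tsupport φ → y ∈ U) : IsTestFunction U fun y => φ (x - y) where
  contDiff := hφ.comp (contDiff_const.sub contDiff_id)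
  hasCompactSupport := hc.comp_homeomorph (Homeomorph.subLeft x)
  tsupport_subset := fun y hy =>
    hx y ((tsupport_comp_eq_preimage φ (Homeomorph.subLeft x)).subset hy)

theorem IsWeakPartial.fderiv_convolution (h : IsWeakPartial U i u v) (hu : LocallyIntegrable u)
    (hφ : ContDiff ℝ ∞ φ) (hc : HasCompactSupport φ) {x : E d}
    (hx : ∀ y, x - y ∈ tsupport φ → y ∈ U) :
    fderiv ℝ (φ ⋆[ContinuousLinearMap.lsmul ℝ ℝ, volume] u) x (stdVec i)
      = (φ ⋆[ContinuousLinearMap.lsmul ℝ ℝ, volume] v) x := by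
  have hderiv (y : E d) :
      fderiv ℝ (fun y => φ (x - y)) y (stdVec i) = -fderiv ℝ φ (x - y) (stdVec i) := by
    have hφ' : HasFDerivAt φ (fderiv ℝ φ (x - y)) (x - y) :=
      (hφ.differentiable (by simp) _).hasFDerivAt
    have hcomp : HasFDerivAt (fun y => φ (x - y)) _ y :=
      hφ'.comp y ((hasFDerivAt_id y).const_sub x)
    simp [hcomp.fderiv]
  have hpart := h.integral_mul_fderiv (IsTestFunction.comp_const_sub hφ hc hx)
  simp only [hderiv, mul_neg, integral_neg, neg_inj] at hpart
  rw [← convolution_flip, (hc.hasFDerivAt_convolution_right _ hu (hφ.of_le (by simp)) x).fderiv,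
    convolution_precompR_apply _ hu (hc.fderiv ℝ) (hφ.continuous_fderiv (by simp)),
    convolution_def, convolution_eq_swap]
  simpa [mul_comm] using hpart

theorem clm_eq_zero_of_apply_stdVec {L : E d →L[ℝ] ℝ} (h : ∀ i, L (stdVec i) = 0) : L = 0 := by
  refine ContinuousLinearMap.coe_injective
    ((EuclideanSpace.basisFun (Fin d) ℝ).toBasis.ext fun i => ?_)
  simpa [stdVec] using h i

theorem convolution_eq_of_isWeakPartial_zero (hu : LocallyIntegrable u) {x₀ : E d} {r R : ℝ}
    (h : ∀ i, IsWeakPartial (Metric.ball x₀ R) i u fun _ => 0) (η : ContDiffBump (0 : E d))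
    (hη : r + η.rOut ≤ R) {x y : E d} (hx : x ∈ Metric.ball x₀ r) (hy : y ∈ Metric.ball x₀ r) :
    (η.normed volume ⋆[ContinuousLinearMap.lsmul ℝ ℝ, volume] u) x
      = (η.normed volume ⋆[ContinuousLinearMap.lsmul ℝ ℝ, volume] u) y := by
  have hφ : ContDiff ℝ ∞ (η.normed volume) := η.contDiff_normed
  have hc : HasCompactSupport (η.normed volume) := η.hasCompactSupport_normed
  refine Metric.isOpen_ball.is_const_of_fderiv_eq_zero (convex_ball x₀ r).isPreconnected
    (fun z _ => ((hc.contDiff_convolution_left (n := 1) _ (hφ.of_le (by simp)) hu).differentiable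
      one_ne_zero z).differentiableWithinAt)
    (fun z hz => clm_eq_zero_of_apply_stdVec fun i => ?_) hx hy
  rw [(h i).fderiv_convolution hu hφ hc]
  · simp [convolution_def]
  · intro w hw
    rw [η.tsupport_normed_eq, mem_closedBall_zero_iff, ← dist_eq_norm, dist_comm] at hw
    rw [Metric.mem_ball] at hz ⊢
    linarith [dist_triangle w z x₀]

theorem exists_contDiffBump_seq : ∃ η : ℕ → ContDiffBump (0 : E d),
    Tendsto (fun k => (η k).rOut) atTop (𝓝 0) ∧ ∀ k, (η k).rOut ≤ 2 * (η k).rIn := by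
  have hpos (k : ℕ) : 0 < 1 / ((k : ℝ) + 1) := by positivity
  refine ⟨fun k => ⟨1 / (k + 1), 2 * (1 / (k + 1)), hpos k, by linarith [hpos k]⟩, ?_,
    fun k => le_rfl⟩
  simpa using (tendsto_one_div_add_atTop_nhds_zero_nat (𝕜 := ℝ)).const_mul 2

theorem exists_ae_eq_const_ball (hu : LocallyIntegrable u) {x₀ : E d} {r R : ℝ} (hr : 0 < r)
    (hrR : r < R) (h : ∀ i, IsWeakPartial (Metric.ball x₀ R) i u fun _ => 0) :
    ∃ c : ℝ, ∀ᵐ x, x ∈ Metric.ball x₀ r → u x = c := by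
  obtain ⟨η, hη, hη₂⟩ := exists_contDiffBump_seq (d := d)
  have hlim := ContDiffBump.ae_convolution_tendsto_right_of_locallyIntegrable (μ := volume) hη
    (Eventually.of_forall hη₂) hu
  obtain ⟨y, hy, hylim⟩ := ((frequently_ae_mem_iff.2
    (Metric.measure_ball_pos volume x₀ hr).ne').and_eventually hlim).exists
  refine ⟨u y, ?_⟩
  filter_upwards [hlim] with x hxlim hx
  refine tendsto_nhds_unique_of_eventuallyEq hxlim hylim ?_
  filter_upwards [hη.eventually_le_const (sub_pos.2 hrR)] with k hk
  exact convolution_eq_of_isWeakPartial_zero hu h (η k) (by linarith) hx hy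

theorem exists_ae_eq_const_of_locally {X Y : Type*} [TopologicalSpace X]
    [SecondCountableTopology X] [MeasurableSpace X] [OpensMeasurableSpace X] {μ : Measure X}
    [μ.IsOpenPosMeasure] {s : Set X} (hs : IsOpen s) (hconn : IsConnected s) {f : X → Y}
    (h : ∀ x ∈ s, ∃ c, ∃ V ∈ 𝓝 x, ∀ᵐ y ∂μ, y ∈ V → f y = c) :
    ∃ c, f =ᵐ[μ.restrict s] fun _ => c := by
  obtain ⟨x₀, hx₀⟩ := hconn.nonempty
  have : Nonempty Y := ⟨f x₀⟩
  choose! c V hV hc using h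
  have hcc : ∀ x ∈ s, c x = c x₀ := fun x hx => by
    refine hconn.isPreconnected.induction₂ (fun x y => c x = c y) (fun x hx => ?_)
      (fun _ _ _ _ _ _ => Eq.trans) (fun _ _ _ _ => Eq.symm) hx hx₀
    filter_upwards [self_mem_nhdsWithin,
      mem_nhdsWithin_of_mem_nhds (eventually_mem_nhds_iff.2 (hV x hx))] with y hy hyx
    have hpos : μ (V x ∩ V y) ≠ 0 :=
      (Measure.measure_pos_of_mem_nhds μ (inter_mem hyx (hV y hy))).ne'
    obtain ⟨z, hz, hzx, hzy⟩ :=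
      ((frequently_ae_mem_iff.2 hpos).and_eventually ((hc x hx).and (hc y hy))).exists
    exact (hzx hz.1).symm.trans (hzy hz.2)
  refine ⟨c x₀, ?_⟩
  rw [EventuallyEq, ae_restrict_iff' hs.measurableSet, ae_iff]
  refine measure_null_of_locally_null _ fun x hx => ?_
  have hxs : x ∈ s := of_not_not fun hxs => hx fun h => absurd h hxs
  refine ⟨_, inter_mem_nhdsWithin _ (hV x hxs), measure_mono_null ?_ (hc x hxs)⟩
  exact fun z ⟨hz, hzV⟩ hzc => hz fun _ => (hzc hzV).trans (hcc x hxs)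

theorem exists_ae_eq_const_of_isWeakPartial_zero (hΘ : IsOpen Θ) (hconn : IsConnected Θ)
    (h : ∀ i, IsWeakPartial Θ i u fun _ => 0) :
    ∃ c : ℝ, u =ᵐ[volume.restrict Θ] fun _ => c := by
  rcases d.eq_zero_or_pos with rfl | hd
  · exact ⟨u 0, Eventually.of_forall fun x => congrArg u (Subsingleton.elim x 0)⟩
  refine exists_ae_eq_const_of_locally hΘ hconn fun x hx => ?_
  obtain ⟨R, hR, hRΘ⟩ := Metric.nhds_basis_closedBall.mem_iff.1 (hΘ.mem_nhds hx)
  set g := (Metric.closedBall x R).indicator u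
  have hgu : ∀ y ∈ Metric.ball x R, g y = u y := fun y hy =>
    Set.indicator_of_mem (Metric.ball_subset_closedBall hy) u
  have hg : LocallyIntegrable g :=
    (((h ⟨0, hd⟩).locallyIntegrableOn.integrableOn_compact_subset hRΘ
      (isCompact_closedBall x R)).integrable_indicator measurableSet_closedBall).locallyIntegrable
  have hg₀ (i : Fin d) : IsWeakPartial (Metric.ball x R) i g fun _ => 0 :=
    ((h i).mono (Metric.ball_subset_closedBall.trans hRΘ)).congr
      (ae_restrict_of_forall_mem measurableSet_ball fun y hy => (hgu y hy).symm) (ae_eq_refl _)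
  obtain ⟨c, hc⟩ := exists_ae_eq_const_ball hg (half_pos hR) (half_lt_self hR) hg₀
  refine ⟨c, _, Metric.ball_mem_nhds x (half_pos hR), ?_⟩
  filter_upwards [hc] with y hy hyR
  rw [← hgu y (Metric.ball_subset_ball (half_le_self hR.le) hyR), hy hyR]

end WeakDerivatives

/-! ### Affine functions -/

section Affine

variable {d : ℕ} {Θ : Set (E d)} {i : Fin d} {u : E d → ℝ}

/-- The affine function `a + ∑ bᵢ xᵢ` of the point `x`; composed with the isometric coordinates, it
is a typical element of the null space. -/
def affineFun (a : ℝ) (b : Fin d → ℝ) (x : E d) : ℝ := a + ∑ i, b i * x i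

theorem contDiff_affineFun (a : ℝ) (b : Fin d → ℝ) : ContDiff ℝ ∞ (affineFun a b) := by
  unfold affineFun
  fun_prop

theorem fderiv_affineFun_stdVec (a : ℝ) (b : Fin d → ℝ) (x : E d) :
    fderiv ℝ (affineFun a b) x (stdVec i) = b i := by
  have h : HasFDerivAt (affineFun a b)
      (∑ i, b i • (EuclideanSpace.proj i : E d →L[ℝ] ℝ)) x :=
    (HasFDerivAt.fun_sum fun i _ =>
      (EuclideanSpace.proj i : E d →L[ℝ] ℝ).hasFDerivAt.const_mul (b i)).const_add a
  simp [h.fderiv, stdVec]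

theorem isWeakPartial_affineFun (a : ℝ) (b : Fin d → ℝ) :
    IsWeakPartial Θ i (affineFun a b) fun _ => b i := by
  simpa only [fderiv_affineFun_stdVec] using
    isWeakPartial_of_contDiff (Θ := Θ) (i := i) (contDiff_affineFun a b)

theorem isWeakPartial_of_ae_eq_affineFun {a : ℝ} {b : Fin d → ℝ}
    (h : u =ᵐ[volume.restrict Θ] affineFun a b) : IsWeakPartial Θ i u fun _ => b i :=
  (isWeakPartial_affineFun a b).congr h.symm (ae_eq_refl _)

theorem isWeakPartial_weakPartial_of_ae_eq_affineFun (hΘ : IsOpen Θ) {j : Fin d} {a : ℝ}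
    {b : Fin d → ℝ} (h : u =ᵐ[volume.restrict Θ] affineFun a b) :
    IsWeakPartial Θ j (weakPartial Θ i u) fun _ => 0 :=
  (isWeakPartial_const (b i)).congr
    ((isWeakPartial_of_ae_eq_affineFun h).weakPartial_ae_eq hΘ).symm (ae_eq_refl _)

theorem exists_ae_eq_affineFun (hΘ : IsOpen Θ) (hconn : IsConnected Θ)
    (h₁ : ∀ i, HasWeakPartial Θ i u)
    (h₂ : ∀ i j, IsWeakPartial Θ j (weakPartial Θ i u) fun _ => 0) :
    ∃ (a : ℝ) (b : Fin d → ℝ), u =ᵐ[volume.restrict Θ] affineFun a b := by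
  choose b hb using fun i => exists_ae_eq_const_of_isWeakPartial_zero hΘ hconn (h₂ i)
  have hsub (i : Fin d) : IsWeakPartial Θ i (fun x => u x - affineFun 0 b x) fun _ => 0 :=
    ((h₁ i).isWeakPartial.sub (isWeakPartial_affineFun 0 b)).congr (ae_eq_refl _) <| by
      filter_upwards [hb i] with x hx using sub_eq_zero.2 hx
  obtain ⟨a, ha⟩ := exists_ae_eq_const_of_isWeakPartial_zero hΘ hconn hsub
  refine ⟨a, b, ?_⟩
  filter_upwards [ha] with x hx
  rw [sub_eq_iff_eq_add] at hx
  simp [hx, affineFun]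

theorem affineFun_eq_zero_of_ae (hΘ : IsOpen Θ) (hne : Θ.Nonempty) {a : ℝ} {b : Fin d → ℝ}
    (h : affineFun a b =ᵐ[volume.restrict Θ] fun _ => 0) : a = 0 ∧ b = 0 := by
  have hcont := (contDiff_affineFun a b).continuous.continuousOn (s := Θ)
  have hzero : Set.EqOn (affineFun a b) (fun _ => 0) Θ :=
    Measure.eqOn_open_of_ae_eq h hΘ hcont continuousOn_const
  obtain ⟨x, hx⟩ := hne
  have hb : b = 0 := funext fun i => by
    have hloc : affineFun a b =ᶠ[𝓝 x] fun _ => 0 :=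
      hzero.eventuallyEq_of_mem (hΘ.mem_nhds hx)
    rw [← fderiv_affineFun_stdVec a b x, hloc.fderiv_eq]
    simp
  exact ⟨by simpa [affineFun, hb] using hzero hx, hb⟩

end Affine

/-! ### Isometric and tangent coordinates -/

section Coordinates

variable {d n : ℕ} {Θ : Set (E d)} {ψ : E d → E n} {x : E d} {p : E n}

theorem IsLocallyIsometricEmbedding.contDiffAt (hψ : IsLocallyIsometricEmbedding Θ ψ)
    (hΘ : IsOpen Θ) (hx : x ∈ Θ) : ContDiffAt ℝ 2 ψ x :=
  (hψ.contDiffOn.contDiffAt (hΘ.mem_nhds hx)).of_le (by norm_cast)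

theorem IsLocallyIsometricEmbedding.inner_fderiv_fderiv_add
    (hψ : IsLocallyIsometricEmbedding Θ ψ) (hΘ : IsOpen Θ) (hx : x ∈ Θ) (u v w : E d) :
    inner ℝ (fderiv ℝ (fderiv ℝ ψ) x u v) (fderiv ℝ ψ x w)
      + inner ℝ (fderiv ℝ (fderiv ℝ ψ) x u w) (fderiv ℝ ψ x v) = 0 := by
  have hd (a : E d) : HasFDerivAt (fun y => fderiv ℝ ψ y a)
      ((fderiv ℝ (fderiv ℝ ψ) x).flip a) x := by
    simpa using (hasFDerivAt_fderiv (hψ.contDiffAt hΘ hx)).clm_apply (hasFDerivAt_const a x)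
  have hconst : (fun y => inner ℝ (fderiv ℝ ψ y v) (fderiv ℝ ψ y w))
      =ᶠ[𝓝 x] fun _ => inner ℝ v w := by
    filter_upwards [hΘ.mem_nhds hx] with y hy using hψ.inner_fderiv y hy v w
  have hzero := ((hd v).inner ℝ (hd w)).unique
    ((hasFDerivAt_const _ x).congr_of_eventuallyEq hconst)
  have hu := DFunLike.congr_fun hzero u
  simp only [ContinuousLinearMap.comp_apply, ContinuousLinearMap.prod_apply,
    fderivInnerCLM_apply, ContinuousLinearMap.flip_apply, zero_apply] at hu
  rw [real_inner_comm (fderiv ℝ ψ x v)]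
  linarith

-- A trilinear form symmetric in two slots and skew in two others vanishes, as in the uniqueness of
-- the Levi-Civita connection.
theorem IsLocallyIsometricEmbedding.inner_fderiv_fderiv_eq_zero
    (hψ : IsLocallyIsometricEmbedding Θ ψ) (hΘ : IsOpen Θ) (hx : x ∈ Θ) (u v w : E d) :
    inner ℝ (fderiv ℝ (fderiv ℝ ψ) x u v) (fderiv ℝ ψ x w) = 0 := by
  have hsymm := fderiv_fderiv_apply_comm (hψ.contDiffAt hΘ hx)
  have hskew := hψ.inner_fderiv_fderiv_add hΘ hx
  have huvw := hskew u v w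
  have hwuv := hskew w u v
  have hvwu := hskew v w u
  rw [hsymm w u, hsymm w v] at hwuv
  rw [hsymm v u] at hvwu
  linarith

theorem IsLocallyIsometricEmbedding.isoCoord_apply (hψ : IsLocallyIsometricEmbedding Θ ψ)
    (hx : x ∈ Θ) : isoCoord Θ ψ (ψ x) = x :=
  (Set.injOn_iff_injective.2 hψ.isEmbedding.injective).leftInvOn_invFunOn hx

theorem isoCoord_mem (hp : p ∈ ψ '' Θ) : isoCoord Θ ψ p ∈ Θ :=
  Function.invFunOn_mem hp

theorem apply_isoCoord (hp : p ∈ ψ '' Θ) : ψ (isoCoord Θ ψ p) = p :=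
  Function.invFunOn_eq hp

theorem IsLocallyIsometricEmbedding.continuousOn_isoCoord
    (hψ : IsLocallyIsometricEmbedding Θ ψ) : ContinuousOn (isoCoord Θ ψ) (ψ '' Θ) := by
  rw [continuousOn_iff_continuous_domRestrict]
  refine continuous_subtype_val.comp (g := Subtype.val)
    (f := fun q : ψ '' Θ => (⟨isoCoord Θ ψ q, isoCoord_mem q.2⟩ : Θ)) ?_
  rw [hψ.isEmbedding.continuous_iff]
  exact continuous_subtype_val.congr fun q => (apply_isoCoord q.2).symm

/-- The differential of `ψ` at `p`, as a linear isometry of `ℝ^d` onto the tangent space. -/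
noncomputable def tangentIsometry (hψ : IsLocallyIsometricEmbedding Θ ψ) (hp : p ∈ ψ '' Θ) :
    E d ≃ₗᵢ[ℝ] tangentSubspace Θ ψ p :=
  ((fderiv ℝ ψ (isoCoord Θ ψ p)).toLinearMap.isometryOfInner
    (hψ.inner_fderiv _ (isoCoord_mem hp))).equivRange

/-- The tangent coordinates `π_p ∘ ψ` around `p`, as functions of the isometric coordinates. -/
noncomputable def tangentCoord (Θ : Set (E d)) (ψ : E d → E n) (p : E n) :
    E d → tangentSubspace Θ ψ p :=
  tangentProj Θ ψ p ∘ ψ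

theorem tangentCoord_isoCoord (hp : p ∈ ψ '' Θ) : tangentCoord Θ ψ p (isoCoord Θ ψ p) = 0 := by
  simp [tangentCoord, tangentProj, apply_isoCoord hp]

theorem contDiff_tangentProj : ContDiff ℝ 2 (tangentProj Θ ψ p) :=
  (tangentSubspace Θ ψ p).orthogonalProjectionOnto.contDiff.comp (contDiff_id.sub contDiff_const)

theorem hasFDerivAt_tangentProj (q : E n) :
    HasFDerivAt (tangentProj Θ ψ p) (tangentSubspace Θ ψ p).orthogonalProjectionOnto q :=
  (tangentSubspace Θ ψ p).orthogonalProjectionOnto.hasFDerivAt.comp q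
    ((hasFDerivAt_id q).sub_const p)

theorem IsLocallyIsometricEmbedding.contDiffAt_tangentCoord
    (hψ : IsLocallyIsometricEmbedding Θ ψ) (hΘ : IsOpen Θ) (hx : x ∈ Θ) :
    ContDiffAt ℝ 2 (tangentCoord Θ ψ p) x :=
  contDiff_tangentProj.contDiffAt.comp x (hψ.contDiffAt hΘ hx)

theorem IsLocallyIsometricEmbedding.hasFDerivAt_tangentCoord
    (hψ : IsLocallyIsometricEmbedding Θ ψ) (hΘ : IsOpen Θ) (hp : p ∈ ψ '' Θ) :
    HasFDerivAt (tangentCoord Θ ψ p)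
      ((tangentIsometry hψ hp).toContinuousLinearEquiv : E d →L[ℝ] tangentSubspace Θ ψ p)
      (isoCoord Θ ψ p) := by
  have hJ : ((tangentIsometry hψ hp).toContinuousLinearEquiv : E d →L[ℝ] tangentSubspace Θ ψ p)
      = (tangentSubspace Θ ψ p).orthogonalProjectionOnto.comp (fderiv ℝ ψ (isoCoord Θ ψ p)) := by
    ext1 v
    exact ((tangentSubspace Θ ψ p).orthogonalProjectionOnto_mem_subspace_eq_self
      (tangentIsometry hψ hp v)).symm
  rw [hJ]
  exact (hasFDerivAt_tangentProj (Θ := Θ) (ψ := ψ) (p := p) _).comp (isoCoord Θ ψ p)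
    ((hψ.contDiffAt hΘ (isoCoord_mem hp)).differentiableAt two_ne_zero).hasFDerivAt

theorem IsLocallyIsometricEmbedding.fderiv_fderiv_tangentCoord
    (hψ : IsLocallyIsometricEmbedding Θ ψ) (hΘ : IsOpen Θ) (hp : p ∈ ψ '' Θ) :
    fderiv ℝ (fderiv ℝ (tangentCoord Θ ψ p)) (isoCoord Θ ψ p) = 0 := by
  have hx := isoCoord_mem hp
  have hproj : fderiv ℝ (tangentProj Θ ψ p)
      = fun _ => (tangentSubspace Θ ψ p).orthogonalProjectionOnto :=
    funext fun q => (hasFDerivAt_tangentProj q).fderiv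
  ext1 u
  ext1 v
  rw [tangentCoord, fderiv_fderiv_comp_apply contDiff_tangentProj.contDiffAt
    (hψ.contDiffAt hΘ hx), hproj]
  simp only [fderiv_fun_const, Pi.zero_apply, zero_apply, zero_add]
  rw [Submodule.orthogonalProjectionOnto_eq_zero_iff, Submodule.mem_orthogonal']
  rintro _ ⟨w, rfl⟩
  exact hψ.inner_fderiv_fderiv_eq_zero hΘ hx u v w

theorem IsLocallyIsometricEmbedding.exists_isTangentParam
    (hψ : IsLocallyIsometricEmbedding Θ ψ) (hΘ : IsOpen Θ) (hp : p ∈ ψ '' Θ) :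
    ∃ s, IsTangentParam Θ ψ p s := by
  have hx := isoCoord_mem hp
  have hG := (hψ.contDiffAt_tangentCoord hΘ hx).hasStrictFDerivAt'
    (hψ.hasFDerivAt_tangentCoord hΘ hp) two_ne_zero
  have hcont := hG.localInverse_continuousAt
  have hzero := hG.localInverse_apply_image
  have hright := hG.eventually_right_inverse
  rw [tangentCoord_isoCoord hp] at hcont hzero hright
  rw [← hzero] at hx
  exact ⟨ψ ∘ hG.localInverse, by rw [Function.comp_apply, hzero, apply_isoCoord hp],
    (hψ.contDiffAt hΘ hx).continuousAt.comp hcont,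
    (hcont.eventually (hΘ.mem_nhds hx)).mono fun _ hv => ⟨_, hv, rfl⟩, hright⟩

theorem IsLocallyIsometricEmbedding.isTangentParam_tangentParam
    (hψ : IsLocallyIsometricEmbedding Θ ψ) (hΘ : IsOpen Θ) (hp : p ∈ ψ '' Θ) :
    IsTangentParam Θ ψ p (tangentParam Θ ψ p) := by
  have h := hψ.exists_isTangentParam hΘ hp
  rw [tangentParam, dif_pos h]
  exact h.choose_spec

section IsTangentParam

variable {s : tangentSubspace Θ ψ p → E n}

theorem IsTangentParam.continuousAt_isoCoord (hs : IsTangentParam Θ ψ p s)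
    (hψ : IsLocallyIsometricEmbedding Θ ψ) (hp : p ∈ ψ '' Θ) :
    ContinuousAt (isoCoord Θ ψ ∘ s) 0 := by
  refine (hψ.continuousOn_isoCoord (s 0) (by rwa [hs.map_zero])).tendsto.comp ?_
  exact tendsto_nhdsWithin_iff.2 ⟨hs.continuousAt, hs.eventually_mem⟩

theorem IsTangentParam.eventually_tangentCoord (hs : IsTangentParam Θ ψ p s) :
    ∀ᶠ v in 𝓝 0, tangentCoord Θ ψ p ((isoCoord Θ ψ ∘ s) v) = v := by
  filter_upwards [hs.eventually_mem, hs.eventually_proj] with v hmem hproj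
  rw [tangentCoord, Function.comp_apply, Function.comp_apply, apply_isoCoord hmem, hproj]

theorem IsTangentParam.hasFDerivAt_isoCoord (hs : IsTangentParam Θ ψ p s)
    (hψ : IsLocallyIsometricEmbedding Θ ψ) (hΘ : IsOpen Θ) (hp : p ∈ ψ '' Θ) :
    HasFDerivAt (isoCoord Θ ψ ∘ s) ((tangentIsometry hψ hp).toContinuousLinearEquiv.symm :
      tangentSubspace Θ ψ p →L[ℝ] E d) 0 := by
  refine HasFDerivAt.of_local_left_inverse (hs.continuousAt_isoCoord hψ hp) ?_
    hs.eventually_tangentCoord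
  rw [Function.comp_apply, hs.map_zero]
  exact hψ.hasFDerivAt_tangentCoord hΘ hp

theorem IsTangentParam.contDiffAt_isoCoord (hs : IsTangentParam Θ ψ p s)
    (hψ : IsLocallyIsometricEmbedding Θ ψ) (hΘ : IsOpen Θ) (hp : p ∈ ψ '' Θ) :
    ContDiffAt ℝ 2 (isoCoord Θ ψ ∘ s) 0 := by
  refine contDiffAt_of_eventually_rightInverse two_ne_zero (G := tangentCoord Θ ψ p)
    (L := (tangentIsometry hψ hp).toContinuousLinearEquiv) ?_ ?_
    (hs.continuousAt_isoCoord hψ hp) hs.eventually_tangentCoord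
  all_goals rw [Function.comp_apply, hs.map_zero]
  · exact hψ.contDiffAt_tangentCoord hΘ (isoCoord_mem hp)
  · exact hψ.hasFDerivAt_tangentCoord hΘ hp

theorem IsTangentParam.fderiv_fderiv_isoCoord (hs : IsTangentParam Θ ψ p s)
    (hψ : IsLocallyIsometricEmbedding Θ ψ) (hΘ : IsOpen Θ) (hp : p ∈ ψ '' Θ) :
    fderiv ℝ (fderiv ℝ (isoCoord Θ ψ ∘ s)) 0 = 0 := by
  refine fderiv_fderiv_eq_zero_of_rightInverse (G := tangentCoord Θ ψ p) ?_
    (hs.contDiffAt_isoCoord hψ hΘ hp) hs.eventually_tangentCoord ?_ ?_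
  all_goals rw [Function.comp_apply, hs.map_zero]
  · exact hψ.contDiffAt_tangentCoord hΘ (isoCoord_mem hp)
  · rw [(hψ.hasFDerivAt_tangentCoord hΘ hp).fderiv]
    exact (tangentIsometry hψ hp).injective
  · exact hψ.fderiv_fderiv_tangentCoord hΘ hp

end IsTangentParam

theorem IsLocallyIsometricEmbedding.tanDeriv_comp_isoCoord (hψ : IsLocallyIsometricEmbedding Θ ψ)
    (hΘ : IsOpen Θ) (hp : p ∈ ψ '' Θ) {F : E d → ℝ} (hF : ContDiffAt ℝ 2 F (isoCoord Θ ψ p))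
    (u : E d) : tanDeriv Θ ψ (F ∘ isoCoord Θ ψ) p (tangentIsometry hψ hp u)
      = fderiv ℝ F (isoCoord Θ ψ p) u := by
  have hs := hψ.isTangentParam_tangentParam hΘ hp
  have hθ := hs.hasFDerivAt_isoCoord hψ hΘ hp
  have hp₀ : (isoCoord Θ ψ ∘ tangentParam Θ ψ p) 0 = isoCoord Θ ψ p := congrArg _ hs.map_zero
  rw [← hp₀] at hF ⊢
  rw [tanDeriv, Function.comp_assoc, fderiv_comp _ (hF.differentiableAt two_ne_zero)
    hθ.differentiableAt, hθ.fderiv]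
  simp

theorem IsLocallyIsometricEmbedding.tanHess_comp_isoCoord (hψ : IsLocallyIsometricEmbedding Θ ψ)
    (hΘ : IsOpen Θ) (hp : p ∈ ψ '' Θ) {F : E d → ℝ} (hF : ContDiffAt ℝ 2 F (isoCoord Θ ψ p))
    (u v : E d) : tanHess Θ ψ (F ∘ isoCoord Θ ψ) p (tangentIsometry hψ hp u)
      (tangentIsometry hψ hp v) = fderiv ℝ (fderiv ℝ F) (isoCoord Θ ψ p) u v := by
  have hs := hψ.isTangentParam_tangentParam hΘ hp
  have hp₀ : (isoCoord Θ ψ ∘ tangentParam Θ ψ p) 0 = isoCoord Θ ψ p := congrArg _ hs.map_zero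
  rw [← hp₀] at hF ⊢
  rw [tanHess, Function.comp_assoc, fderiv_fderiv_comp_apply hF
    (hs.contDiffAt_isoCoord hψ hΘ hp), (hs.hasFDerivAt_isoCoord hψ hΘ hp).fderiv,
    hs.fderiv_fderiv_isoCoord hψ hΘ hp]
  simp

end Coordinates

/-! ### Weak differential and Hessian in an orthonormal frame -/

section Frame

variable {d n : ℕ} {Θ : Set (E d)} {ψ : E d → E n} {p : E n} {f : E n → ℝ} {u : E d → ℝ} {x : E d}

/-- The differential of a function on `Θ ⊆ ℝ^d` assembled from its weak partial derivatives. -/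
noncomputable def weakGrad (Θ : Set (E d)) (u : E d → ℝ) (x : E d) : E d →L[ℝ] ℝ :=
  ∑ i, weakPartial Θ i u x • EuclideanSpace.proj i

/-- The Hessian of a function on `Θ ⊆ ℝ^d` assembled from its second weak partial derivatives; the
`(i, j)` entry is `∂_j ∂_i u`, and symmetry holds only almost everywhere. -/
noncomputable def weakHess (Θ : Set (E d)) (u : E d → ℝ) (x : E d) : E d →L[ℝ] E d →L[ℝ] ℝ :=
  ∑ i, ∑ j, weakPartial Θ j (weakPartial Θ i u) x •
    (EuclideanSpace.proj i : E d →L[ℝ] ℝ).smulRight (EuclideanSpace.proj j : E d →L[ℝ] ℝ)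

theorem weakGrad_stdVec (i : Fin d) : weakGrad Θ u x (stdVec i) = weakPartial Θ i u x := by
  simp [weakGrad, stdVec]

theorem weakHess_stdVec (i j : Fin d) :
    weakHess Θ u x (stdVec i) (stdVec j) = weakPartial Θ j (weakPartial Θ i u) x := by
  simp [weakHess, stdVec]

theorem jet_eq : jet Θ ψ f p =
    quadratic (f p) (weakGrad Θ (f ∘ ψ) (isoCoord Θ ψ p)) (weakHess Θ (f ∘ ψ) (isoCoord Θ ψ p))
      (isoCoord Θ ψ p) ∘ isoCoord Θ ψ := by
  ext q
  simp [jet, quadratic, weakGrad, weakHess, mul_assoc]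

/-- The orthonormal frame `∂_i ψ` of the tangent space at `p`. -/
noncomputable def tangentBasis (hψ : IsLocallyIsometricEmbedding Θ ψ) (hp : p ∈ ψ '' Θ) :
    OrthonormalBasis (Fin d) ℝ (tangentSubspace Θ ψ p) :=
  (EuclideanSpace.basisFun (Fin d) ℝ).map (tangentIsometry hψ hp)

theorem tangentBasis_apply (hψ : IsLocallyIsometricEmbedding Θ ψ) (hp : p ∈ ψ '' Θ) (i : Fin d) :
    tangentBasis hψ hp i = tangentIsometry hψ hp (stdVec i) := by
  simp [tangentBasis, stdVec]

theorem IsLocallyIsometricEmbedding.weakTanDeriv_tangentBasis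
    (hψ : IsLocallyIsometricEmbedding Θ ψ) (hΘ : IsOpen Θ) (hp : p ∈ ψ '' Θ) (i : Fin d) :
    weakTanDeriv Θ ψ f p (tangentBasis hψ hp i)
      = weakPartial Θ i (f ∘ ψ) (isoCoord Θ ψ p) := by
  rw [weakTanDeriv, jet_eq, tangentBasis_apply,
    hψ.tanDeriv_comp_isoCoord hΘ hp (contDiff_quadratic ..).contDiffAt, fderiv_quadratic]
  simp [weakGrad_stdVec]

theorem IsLocallyIsometricEmbedding.weakTanHess_tangentBasis
    (hψ : IsLocallyIsometricEmbedding Θ ψ) (hΘ : IsOpen Θ) (hp : p ∈ ψ '' Θ) (i j : Fin d) :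
    weakTanHess Θ ψ f p (tangentBasis hψ hp i) (tangentBasis hψ hp j)
      = 1 / 2 * (weakPartial Θ j (weakPartial Θ i (f ∘ ψ)) (isoCoord Θ ψ p)
        + weakPartial Θ i (weakPartial Θ j (f ∘ ψ)) (isoCoord Θ ψ p)) := by
  rw [weakTanHess, jet_eq, tangentBasis_apply, tangentBasis_apply,
    hψ.tanHess_comp_isoCoord hΘ hp (contDiff_quadratic ..).contDiffAt,
    fderiv_fderiv_quadratic_apply, weakHess_stdVec, weakHess_stdVec]

theorem frobSq_eq_sum {V ι : Type*} [NormedAddCommGroup V] [InnerProductSpace ℝ V]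
    [FiniteDimensional ℝ V] [Fintype ι] (b : OrthonormalBasis ι ℝ V) (B : V →L[ℝ] V →L[ℝ] ℝ) :
    frobSq B = ∑ i, ∑ j, B (b i) (b j) ^ 2 := by
  have hswap (L : V →L[ℝ] ℝ) : ∑ a, L (stdOrthonormalBasis ℝ V a) ^ 2 = ∑ i, L (b i) ^ 2 :=
    ((stdOrthonormalBasis ℝ V).norm_dual L).symm.trans (b.norm_dual L)
  calc frobSq B = ∑ a, ∑ j, B (stdOrthonormalBasis ℝ V a) (b j) ^ 2 :=
        Finset.sum_congr rfl fun a _ => hswap (B _)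
    _ = ∑ j, ∑ a, B.flip (b j) (stdOrthonormalBasis ℝ V a) ^ 2 := Finset.sum_comm
    _ = ∑ j, ∑ i, B (b i) (b j) ^ 2 := Finset.sum_congr rfl fun j _ => hswap (B.flip _)
    _ = ∑ i, ∑ j, B (b i) (b j) ^ 2 := Finset.sum_comm

theorem IsLocallyIsometricEmbedding.norm_sq_weakTanDeriv (hψ : IsLocallyIsometricEmbedding Θ ψ)
    (hΘ : IsOpen Θ) (hp : p ∈ ψ '' Θ) : ‖weakTanDeriv Θ ψ f p‖ ^ 2
      = ∑ i, weakPartial Θ i (f ∘ ψ) (isoCoord Θ ψ p) ^ 2 := by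
  simp [(tangentBasis hψ hp).norm_dual, hψ.weakTanDeriv_tangentBasis hΘ]

theorem IsLocallyIsometricEmbedding.frobSq_weakTanHess (hψ : IsLocallyIsometricEmbedding Θ ψ)
    (hΘ : IsOpen Θ) (hp : p ∈ ψ '' Θ) : frobSq (weakTanHess Θ ψ f p) = ∑ i, ∑ j,
      (1 / 2 * (weakPartial Θ j (weakPartial Θ i (f ∘ ψ)) (isoCoord Θ ψ p)
        + weakPartial Θ i (weakPartial Θ j (f ∘ ψ)) (isoCoord Θ ψ p))) ^ 2 := by
  simp only [frobSq_eq_sum (tangentBasis hψ hp), hψ.weakTanHess_tangentBasis hΘ hp]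

end Frame

/-! ### The Riemannian volume -/

section RiemannianVolume

variable {d n : ℕ} {Θ : Set (E d)} {ψ : E d → E n} {ν : Measure (E n)}

theorem IsLocallyIsometricEmbedding.gramMatrix_eq_one (hψ : IsLocallyIsometricEmbedding Θ ψ)
    {x : E d} (hx : x ∈ Θ) : gramMatrix ψ x = 1 := by
  ext i j
  rw [gramMatrix, Matrix.of_apply, hψ.inner_fderiv x hx, stdVec, stdVec, Matrix.one_apply]
  simp [EuclideanSpace.inner_single_left]

theorem IsLocallyIsometricEmbedding.riemVolume_eq_map (hψ : IsLocallyIsometricEmbedding Θ ψ)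
    (hΘ : IsOpen Θ) : riemVolume Θ ψ = (volume.restrict Θ).map ψ := by
  have hdensity : (volume.restrict Θ).withDensity (fun x => ENNReal.ofReal √(gramMatrix ψ x).det)
      = volume.restrict Θ := by
    refine (withDensity_congr_ae ?_).trans withDensity_one
    filter_upwards [ae_restrict_mem hΘ.measurableSet] with x hx
    simp [hψ.gramMatrix_eq_one hx]
  rw [riemVolume, hdensity]

theorem IsLocallyIsometricEmbedding.riemVolume_eq_map_domRestrict
    (hψ : IsLocallyIsometricEmbedding Θ ψ) (hΘ : IsOpen Θ) :
    riemVolume Θ ψ = ((volume : Measure (E d)).comap ((↑) : Θ → E d)).map (Θ.domRestrict ψ) := by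
  have hmeas : AEMeasurable ψ (volume.restrict Θ) :=
    hψ.contDiffOn.continuousOn.aemeasurable hΘ.measurableSet
  rw [hψ.riemVolume_eq_map hΘ]
  rw [← map_comap_subtype_coe hΘ.measurableSet] at hmeas ⊢
  exact AEMeasurable.map_map_of_aemeasurable hmeas measurable_subtype_coe.aemeasurable

theorem IsLocallyIsometricEmbedding.measurableEmbedding (hψ : IsLocallyIsometricEmbedding Θ ψ)
    (hΘ : IsOpen Θ) : MeasurableEmbedding (Θ.domRestrict ψ) :=
  hψ.contDiffOn.continuousOn.measurableEmbedding hΘ.measurableSet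
    (Set.injOn_iff_injective.2 hψ.isEmbedding.injective)

theorem IsLocallyIsometricEmbedding.ae_riemVolume_iff (hψ : IsLocallyIsometricEmbedding Θ ψ)
    (hΘ : IsOpen Θ) {P : E n → Prop} :
    (∀ᵐ p ∂riemVolume Θ ψ, P p) ↔ ∀ᵐ x ∂volume.restrict Θ, P (ψ x) := by
  rw [hψ.riemVolume_eq_map_domRestrict hΘ, (hψ.measurableEmbedding hΘ).ae_map_iff,
    ← map_comap_subtype_coe hΘ.measurableSet,
    (MeasurableEmbedding.subtype_coe hΘ.measurableSet).ae_map_iff]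
  rfl

theorem IsLocallyIsometricEmbedding.aemeasurable_riemVolume_iff
    (hψ : IsLocallyIsometricEmbedding Θ ψ) (hΘ : IsOpen Θ) {β : Type*} [MeasurableSpace β]
    {g : E n → β} :
    AEMeasurable g (riemVolume Θ ψ) ↔ AEMeasurable (g ∘ ψ) (volume.restrict Θ) := by
  rw [hψ.riemVolume_eq_map_domRestrict hΘ, (hψ.measurableEmbedding hΘ).aemeasurable_map_iff,
    ← map_comap_subtype_coe hΘ.measurableSet,
    (MeasurableEmbedding.subtype_coe hΘ.measurableSet).aemeasurable_map_iff]
  rfl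

theorem IsLocallyIsometricEmbedding.ae_mem_image (hψ : IsLocallyIsometricEmbedding Θ ψ)
    (hΘ : IsOpen Θ) : ∀ᵐ p ∂riemVolume Θ ψ, p ∈ ψ '' Θ := by
  rw [hψ.ae_riemVolume_iff hΘ]
  filter_upwards [ae_restrict_mem hΘ.measurableSet] with x hx using Set.mem_image_of_mem ψ hx

theorem IsLocallyIsometricEmbedding.ae_withDensity_riemVolume
    (hψ : IsLocallyIsometricEmbedding Θ ψ) (hΘ : IsOpen Θ) {ρ : E n → ℝ} (hρ : Measurable ρ)
    (hpos : ∀ p ∈ ψ '' Θ, 0 < ρ p) :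
    ae ((riemVolume Θ ψ).withDensity fun p => ENNReal.ofReal (ρ p)) = ae (riemVolume Θ ψ) := by
  refine (withDensity_absolutelyContinuous _ _).ae_le.antisymm
    (withDensity_absolutelyContinuous' hρ.ennreal_ofReal.aemeasurable ?_).ae_le
  filter_upwards [hψ.ae_mem_image hΘ] with p hp
  simpa using hpos p hp

theorem IsLocallyIsometricEmbedding.comp_isoCoord_comp_ae_eq
    (hψ : IsLocallyIsometricEmbedding Θ ψ) (hΘ : IsOpen Θ) {β : Type*} (g : E d → β) :
    (g ∘ isoCoord Θ ψ) ∘ ψ =ᵐ[volume.restrict Θ] g := by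
  filter_upwards [ae_restrict_mem hΘ.measurableSet] with x hx
  rw [Function.comp_apply, Function.comp_apply, hψ.isoCoord_apply hx]

theorem IsLocallyIsometricEmbedding.ae_eq_comp_isoCoord_iff
    (hψ : IsLocallyIsometricEmbedding Θ ψ) (hΘ : IsOpen Θ) (hν : ae ν = ae (riemVolume Θ ψ))
    {β : Type*} {f : E n → β} {g : E d → β} :
    f =ᵐ[ν] g ∘ isoCoord Θ ψ ↔ f ∘ ψ =ᵐ[volume.restrict Θ] g := by
  have hg := hψ.comp_isoCoord_comp_ae_eq hΘ g
  rw [EventuallyEq, hν, hψ.ae_riemVolume_iff hΘ]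
  exact ⟨fun h => EventuallyEq.trans h hg, fun h => h.trans hg.symm⟩

theorem IsLocallyIsometricEmbedding.comp_isoCoord_ae_eq
    (hψ : IsLocallyIsometricEmbedding Θ ψ) (hΘ : IsOpen Θ) (hν : ν ≪ riemVolume Θ ψ)
    {β : Type*} {g h : E d → β} (hgh : g =ᵐ[volume.restrict Θ] h) :
    g ∘ isoCoord Θ ψ =ᵐ[ν] h ∘ isoCoord Θ ψ :=
  hν.ae_eq <| (hψ.ae_eq_comp_isoCoord_iff hΘ rfl).2 <|
    (hψ.comp_isoCoord_comp_ae_eq hΘ g).trans hgh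

theorem IsLocallyIsometricEmbedding.aemeasurable_comp_isoCoord
    (hψ : IsLocallyIsometricEmbedding Θ ψ) (hΘ : IsOpen Θ) (hν : ν ≪ riemVolume Θ ψ)
    {β : Type*} [MeasurableSpace β] {g : E d → β} (hg : AEMeasurable g (volume.restrict Θ)) :
    AEMeasurable (g ∘ isoCoord Θ ψ) ν :=
  ((hψ.aemeasurable_riemVolume_iff hΘ).2
    (hg.congr (hψ.comp_isoCoord_comp_ae_eq hΘ g).symm)).mono_ac hν

end RiemannianVolume

/-! ### The null space of the Hessian form -/

section HessForm

variable {d n : ℕ} {Θ : Set (E d)} {ψ : E d → E n} {μ ν : Measure (E n)} {f : E n → ℝ}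

theorem frobSq_weakTanHess_ae_eq (hψ : IsLocallyIsometricEmbedding Θ ψ) (hΘ : IsOpen Θ)
    (hμ : μ ≪ riemVolume Θ ψ) (h₁ : ∀ i, HasWeakPartial Θ i (f ∘ ψ))
    (h₂ : ∀ i j, HasWeakPartial Θ j (weakPartial Θ i (f ∘ ψ))) :
    (fun p => frobSq (weakTanHess Θ ψ f p)) =ᵐ[μ]
      (fun x => ∑ i, ∑ j, weakPartial Θ j (weakPartial Θ i (f ∘ ψ)) x ^ 2) ∘ isoCoord Θ ψ := by
  have hsymm (i j : Fin d) : weakPartial Θ i (weakPartial Θ j (f ∘ ψ)) ∘ isoCoord Θ ψ =ᵐ[μ]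
      weakPartial Θ j (weakPartial Θ i (f ∘ ψ)) ∘ isoCoord Θ ψ :=
    hψ.comp_isoCoord_ae_eq hΘ hμ <| IsWeakPartial.ae_eq_swap hΘ (h₁ j).isWeakPartial
      (h₁ i).isWeakPartial (h₂ j i).isWeakPartial (h₂ i j).isWeakPartial
  filter_upwards [hμ.ae_le (hψ.ae_mem_image hΘ),
    ae_all_iff.2 fun i => ae_all_iff.2 (hsymm i)] with p hp hsymm
  simp only [Function.comp_apply] at hsymm ⊢
  rw [hψ.frobSq_weakTanHess hΘ hp]
  refine Finset.sum_congr rfl fun i _ => Finset.sum_congr rfl fun j _ => ?_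
  rw [hsymm i j]
  ring

theorem hessForm_eq_zero_iff (hψ : IsLocallyIsometricEmbedding Θ ψ) (hΘ : IsOpen Θ)
    (hμ : ae μ = ae (riemVolume Θ ψ)) (h₁ : ∀ i, HasWeakPartial Θ i (f ∘ ψ))
    (h₂ : ∀ i j, HasWeakPartial Θ j (weakPartial Θ i (f ∘ ψ))) :
    hessForm Θ ψ μ f = 0 ↔
      ∀ i j, weakPartial Θ j (weakPartial Θ i (f ∘ ψ)) =ᵐ[volume.restrict Θ] fun _ => 0 := by
  set Q : E d → ℝ := fun x => ∑ i, ∑ j, weakPartial Θ j (weakPartial Θ i (f ∘ ψ)) x ^ 2 with hQ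
  have hac : μ ≪ riemVolume Θ ψ := Measure.ae_le_iff_absolutelyContinuous.1 hμ.le
  have hQ_meas : AEMeasurable Q (volume.restrict Θ) :=
    Finset.aemeasurable_fun_sum _ fun i _ => Finset.aemeasurable_fun_sum _ fun j _ =>
      (h₂ i j).isWeakPartial.2.aestronglyMeasurable.aemeasurable.pow_const 2
  have hQ_nonpos (x : E d) :
      Q x ≤ 0 ↔ ∀ i j, weakPartial Θ j (weakPartial Θ i (f ∘ ψ)) x = 0 := by
    have hQ_nonneg : 0 ≤ Q x :=
      Finset.sum_nonneg fun i _ => Finset.sum_nonneg fun j _ => sq_nonneg _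
    rw [hQ_nonneg.ge_iff_eq']
    simp [hQ, Finset.sum_eq_zero_iff_of_nonneg, Finset.sum_nonneg, sq_nonneg]
  have hfrob : (fun p => ENNReal.ofReal (frobSq (weakTanHess Θ ψ f p))) =ᵐ[μ]
      (fun x => ENNReal.ofReal (Q x)) ∘ isoCoord Θ ψ :=
    (frobSq_weakTanHess_ae_eq hψ hΘ hac h₁ h₂).fun_comp ENNReal.ofReal
  calc hessForm Θ ψ μ f = 0
      ↔ (fun x => ENNReal.ofReal (Q x)) ∘ isoCoord Θ ψ =ᵐ[μ] (fun _ => 0) ∘ isoCoord Θ ψ := by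
        rw [hessForm, lintegral_congr_ae hfrob, lintegral_eq_zero_iff'
          (hψ.aemeasurable_comp_isoCoord hΘ hac hQ_meas.ennreal_ofReal)]
        rfl
    _ ↔ (fun x => ENNReal.ofReal (Q x)) =ᵐ[volume.restrict Θ] fun _ => 0 := by
        rw [hψ.ae_eq_comp_isoCoord_iff hΘ hμ]
        exact ⟨(hψ.comp_isoCoord_comp_ae_eq hΘ _).symm.trans,
          (hψ.comp_isoCoord_comp_ae_eq hΘ _).trans⟩
    _ ↔ _ := by simp only [EventuallyEq, ENNReal.ofReal_eq_zero, hQ_nonpos, ae_all_iff]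

theorem hessForm_eq_zero_iff_exists_affineFun (hψ : IsLocallyIsometricEmbedding Θ ψ)
    (hΘ : IsOpen Θ) (hconn : IsConnected Θ) (hμ : ae μ = ae (riemVolume Θ ψ))
    (h₁ : ∀ i, HasWeakPartial Θ i (f ∘ ψ))
    (h₂ : ∀ i j, HasWeakPartial Θ j (weakPartial Θ i (f ∘ ψ))) :
    hessForm Θ ψ μ f = 0 ↔
      ∃ (a : ℝ) (b : Fin d → ℝ), f ∘ ψ =ᵐ[volume.restrict Θ] affineFun a b := by
  rw [hessForm_eq_zero_iff hψ hΘ hμ h₁ h₂]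
  refine ⟨fun h => exists_ae_eq_affineFun hΘ hconn h₁ fun i j =>
    (h₂ i j).isWeakPartial.congr (ae_eq_refl _) (h i j), ?_⟩
  rintro ⟨a, b, h⟩ i j
  exact (isWeakPartial_weakPartial_of_ae_eq_affineFun hΘ h).weakPartial_ae_eq hΘ

theorem lintegral_norm_sq_weakTanDeriv_lt_top [IsFiniteMeasure ν]
    (hψ : IsLocallyIsometricEmbedding Θ ψ) (hΘ : IsOpen Θ) (hν : ν ≪ riemVolume Θ ψ) {a : ℝ}
    {b : Fin d → ℝ} (h : f ∘ ψ =ᵐ[volume.restrict Θ] affineFun a b) :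
    ∫⁻ p, ENNReal.ofReal (‖weakTanDeriv Θ ψ f p‖ ^ 2) ∂ν < ⊤ := by
  have hgrad (i : Fin d) : weakPartial Θ i (f ∘ ψ) ∘ isoCoord Θ ψ =ᵐ[ν] fun _ => b i :=
    hψ.comp_isoCoord_ae_eq hΘ hν ((isWeakPartial_of_ae_eq_affineFun h).weakPartial_ae_eq hΘ)
  have hconst : (fun p => ENNReal.ofReal (‖weakTanDeriv Θ ψ f p‖ ^ 2)) =ᵐ[ν]
      fun _ => ENNReal.ofReal (∑ i, b i ^ 2) := by
    filter_upwards [hν.ae_le (hψ.ae_mem_image hΘ), ae_all_iff.2 hgrad] with p hp hgrad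
    simp only [Function.comp_apply] at hgrad
    simp only [hψ.norm_sq_weakTanDeriv hΘ hp, hgrad]
  rw [lintegral_congr_ae hconst]
  exact lintegral_const_lt_top ENNReal.ofReal_ne_top

theorem mem_W22_of_ae_eq_affineFun [IsFiniteMeasure ν] (hψ : IsLocallyIsometricEmbedding Θ ψ)
    (hΘ : IsOpen Θ) (hν : ae ν = ae (riemVolume Θ ψ)) {a : ℝ} {b : Fin d → ℝ} {f : Lp ℝ 2 ν}
    (h : f ∘ ψ =ᵐ[volume.restrict Θ] affineFun a b) : f ∈ W22 Θ ψ ν := by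
  have h₁ (i : Fin d) : HasWeakPartial Θ i (f ∘ ψ) := ⟨_, isWeakPartial_of_ae_eq_affineFun h⟩
  have h₂ (i j : Fin d) : IsWeakPartial Θ j (weakPartial Θ i (f ∘ ψ)) fun _ => 0 :=
    isWeakPartial_weakPartial_of_ae_eq_affineFun hΘ h
  have hhess : hessForm Θ ψ ν f = 0 :=
    (hessForm_eq_zero_iff hψ hΘ hν h₁ fun i j => ⟨_, h₂ i j⟩).2 fun i j =>
      (h₂ i j).weakPartial_ae_eq hΘ
  exact ⟨h₁, fun i j => ⟨_, h₂ i j⟩, lintegral_norm_sq_weakTanDeriv_lt_top hψ hΘ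
    (Measure.ae_le_iff_absolutelyContinuous.1 hν.le) h, hhess.trans_lt ENNReal.zero_lt_top⟩

theorem hessForm_eq_zero_iff_of_mem_W22 (hψ : IsLocallyIsometricEmbedding Θ ψ)
    (hΘ : IsOpen Θ) (hconn : IsConnected Θ) (hμ : ae μ = ae (riemVolume Θ ψ))
    (hν : ae ν = ae (riemVolume Θ ψ)) {f : Lp ℝ 2 ν} (hf : f ∈ W22 Θ ψ ν) :
    hessForm Θ ψ μ f = 0 ↔
      ∃ (a : ℝ) (b : Fin d → ℝ), f =ᵐ[ν] affineFun a b ∘ isoCoord Θ ψ := by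
  simp only [hψ.ae_eq_comp_isoCoord_iff hΘ hν]
  exact hessForm_eq_zero_iff_exists_affineFun hψ hΘ hconn hμ hf.1 hf.2.1

theorem mem_nullSpace_iff [IsFiniteMeasure ν] (hψ : IsLocallyIsometricEmbedding Θ ψ)
    (hΘ : IsOpen Θ) (hconn : IsConnected Θ) (hμ : ae μ = ae (riemVolume Θ ψ))
    (hν : ae ν = ae (riemVolume Θ ψ)) {f : Lp ℝ 2 ν} :
    f ∈ nullSpace Θ ψ ν μ ↔
      ∃ (a : ℝ) (b : Fin d → ℝ), f =ᵐ[ν] affineFun a b ∘ isoCoord Θ ψ := by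
  have hzero := @hessForm_eq_zero_iff_of_mem_W22 d n Θ ψ μ ν hψ hΘ hconn hμ hν f
  refine ⟨fun h => (hzero h.1).1 h.2, fun h => ?_⟩
  have hf : f ∈ W22 Θ ψ ν := by
    obtain ⟨a, b, h⟩ := h
    exact mem_W22_of_ae_eq_affineFun hψ hΘ hν ((hψ.ae_eq_comp_isoCoord_iff hΘ hν).1 h)
  exact ⟨hf, (hzero hf).2 h⟩

end HessForm

section SquareIntegrable

variable {d : ℕ} {X : Type*} [MeasurableSpace X] {ν : Measure X} {y : X → E d}

theorem isFiniteMeasure_of_lintegral_one_add_sq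
    (h : ∫⁻ x, ENNReal.ofReal (1 + ‖y x‖ ^ 2) ∂ν < ⊤) : IsFiniteMeasure ν := by
  refine ⟨lt_of_le_of_lt ?_ h⟩
  rw [← lintegral_one, ← ENNReal.ofReal_one]
  gcongr
  exact le_add_of_nonneg_right (sq_nonneg _)

theorem memLp_two_of_lintegral_one_add_sq (hy : AEMeasurable y ν)
    (h : ∫⁻ x, ENNReal.ofReal (1 + ‖y x‖ ^ 2) ∂ν < ⊤) : MemLp y 2 ν := by
  rw [memLp_two_iff_integrable_sq_norm hy.aestronglyMeasurable]
  refine ⟨(hy.norm.pow_const 2).aestronglyMeasurable, ?_⟩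
  rw [hasFiniteIntegral_iff_ofReal (Eventually.of_forall fun x => sq_nonneg _)]
  refine lt_of_le_of_lt ?_ h
  gcongr
  exact le_add_of_nonneg_left zero_le_one

end SquareIntegrable

section AffineSpan

variable {d : ℕ} {X : Type*} [MeasurableSpace X] {ν : Measure X} {q : ℝ≥0∞} {y : X → E d}
  {one : Lp ℝ q ν} {θ : Fin d → Lp ℝ q ν}

theorem coeFn_smul_add_sum_smul (hone : one =ᵐ[ν] fun _ => 1)
    (hθ : ∀ i, θ i =ᵐ[ν] fun x => y x i) (a : ℝ) (b : Fin d → ℝ) :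
    (a • one + ∑ i, b i • θ i : Lp ℝ q ν) =ᵐ[ν] affineFun a b ∘ y := by
  filter_upwards [Lp.coeFn_add (a • one) (∑ i, b i • θ i), Lp.coeFn_smul a one,
    Lp.coeFn_fun_finsetSum Finset.univ fun i => b i • θ i,
    ae_all_iff.2 fun i => Lp.coeFn_smul (b i) (θ i), hone, ae_all_iff.2 hθ]
    with x hadd hsmul_one hsum hsmul_θ hone hθ
  rw [hadd, Pi.add_apply, hsmul_one, hsum, Pi.smul_apply, hone]
  simp [hsmul_θ, hθ, affineFun]

theorem mem_span_insert_range_iff (hone : one =ᵐ[ν] fun _ => 1)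
    (hθ : ∀ i, θ i =ᵐ[ν] fun x => y x i) {f : Lp ℝ q ν} :
    f ∈ Submodule.span ℝ (insert one (Set.range θ)) ↔
      ∃ (a : ℝ) (b : Fin d → ℝ), f =ᵐ[ν] affineFun a b ∘ y := by
  simp only [Submodule.mem_span_insert, Submodule.mem_span_range_iff_exists_fun]
  constructor
  · rintro ⟨a, _, ⟨b, rfl⟩, rfl⟩
    exact ⟨a, b, coeFn_smul_add_sum_smul hone hθ a b⟩
  · rintro ⟨a, b, h⟩
    exact ⟨a, _, ⟨b, rfl⟩, Lp.ext (h.trans (coeFn_smul_add_sum_smul hone hθ a b).symm)⟩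

theorem finrank_span_insert_range (hone : one =ᵐ[ν] fun _ => 1)
    (hθ : ∀ i, θ i =ᵐ[ν] fun x => y x i)
    (hy : ∀ a b, affineFun a b ∘ y =ᵐ[ν] (fun _ => 0) → a = 0 ∧ b = 0) :
    Module.finrank ℝ (Submodule.span ℝ (insert one (Set.range θ))) = d + 1 := by
  have hli : LinearIndependent ℝ (Fin.cons one θ : Fin (d + 1) → Lp ℝ q ν) := by
    rw [Fintype.linearIndependent_iff]
    intro g hg
    simp only [Fin.sum_univ_succ, Fin.cons_zero, Fin.cons_succ] at hg
    have hcomb := coeFn_smul_add_sum_smul hone hθ (g 0) fun i => g i.succ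
    rw [hg] at hcomb
    obtain ⟨h_zero, h_succ⟩ := hy _ _ (hcomb.symm.trans (Lp.coeFn_zero ℝ q ν))
    exact Fin.cases h_zero (congrFun h_succ)
  rw [← Fin.range_cons, finrank_span_eq_card hli, Fintype.card_fin]

end AffineSpan

end HessianForm

open HessianForm in
theorem theorem1_general {d n : ℕ} {Θ : Set (E d)} (hΘ : IsOpen Θ) (hconn : IsConnected Θ)
    {ψ : E d → E n} (hψ : IsLocallyIsometricEmbedding Θ ψ) {μ ν : Measure (E n)}
    (hμ : ae μ = ae (riemVolume Θ ψ)) (hν : ae ν = ae (riemVolume Θ ψ)) :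
    (∀ f ∈ W22 Θ ψ ν, hessForm Θ ψ μ f = 0 ↔
      ∃ (a : ℝ) (b : Fin d → ℝ),
        f =ᵐ[ν] fun p => a + ∑ i, b i * isoCoord Θ ψ p i) ∧
    (∫⁻ p, ENNReal.ofReal (1 + ‖isoCoord Θ ψ p‖ ^ 2) ∂ν < ⊤ →
      ∃ (N : Submodule ℝ (Lp ℝ 2 ν)) (one : Lp ℝ 2 ν) (θ : Fin d → Lp ℝ 2 ν),
        (N : Set (Lp ℝ 2 ν)) = nullSpace Θ ψ ν μ ∧
        (one =ᵐ[ν] fun _ => (1 : ℝ)) ∧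
        (∀ i, θ i =ᵐ[ν] fun p => isoCoord Θ ψ p i) ∧
        N = Submodule.span ℝ (insert one (Set.range θ)) ∧
        Module.finrank ℝ N = d + 1) := by
  refine ⟨fun f hf => hessForm_eq_zero_iff_of_mem_W22 hψ hΘ hconn hμ hν hf, fun hint => ?_⟩
  have hac : ν ≪ riemVolume Θ ψ := Measure.ae_le_iff_absolutelyContinuous.1 hν.le
  have : IsFiniteMeasure ν := isFiniteMeasure_of_lintegral_one_add_sq hint
  have hLp : MemLp (isoCoord Θ ψ) 2 ν := memLp_two_of_lintegral_one_add_sq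
    (hψ.aemeasurable_comp_isoCoord hΘ hac aemeasurable_id) hint
  set one : Lp ℝ 2 ν := (memLp_const (1 : ℝ)).toLp
  set θ : Fin d → Lp ℝ 2 ν := fun i => (hLp.eval_piLp i).toLp
  have hone : one =ᵐ[ν] fun _ => 1 := MemLp.coeFn_toLp _
  have hθ (i : Fin d) : θ i =ᵐ[ν] fun p => isoCoord Θ ψ p i := MemLp.coeFn_toLp _
  refine ⟨Submodule.span ℝ (insert one (Set.range θ)), one, θ, ?_, hone, hθ, rfl, ?_⟩
  · ext f
    exact (mem_span_insert_range_iff hone hθ).trans (mem_nullSpace_iff hψ hΘ hconn hμ hν).symm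
  · exact finrank_span_insert_range hone hθ fun a b h =>
      affineFun_eq_zero_of_ae hΘ hconn.nonempty <|
        (hψ.comp_isoCoord_comp_ae_eq hΘ _).symm.trans ((hψ.ae_eq_comp_isoCoord_iff hΘ hν).1 h)

theorem theorem1 {d n : ℕ} (Θ : Set (HessianForm.E d)) (hΘ_open : IsOpen Θ)
    (hΘ_conn : IsConnected Θ)
    (ψ : HessianForm.E d → HessianForm.E n)
    (hψ : HessianForm.IsLocallyIsometricEmbedding Θ ψ)
    -- the sampling measure: a probability measure on `M = ψ(Θ)` with positive density
    (ρ : HessianForm.E n → ℝ) (hρ_meas : Measurable ρ) (hρ_pos : ∀ p ∈ ψ '' Θ, 0 < ρ p)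
    (μ : Measure (HessianForm.E n)) [IsProbabilityMeasure μ]
    (hμ : μ = (HessianForm.riemVolume Θ ψ).withDensity fun p => ENNReal.ofReal (ρ p))
    -- square integrability in `W^{2,2}(M)` refers to the Riemannian volume, or to `μ`
    (ν : Measure (HessianForm.E n)) (hν : ν = HessianForm.riemVolume Θ ψ ∨ ν = μ) :
    -- a function in `W^{2,2}(M)` is in the null space iff it is affine in the coordinates `θ^i`
    (∀ f ∈ HessianForm.W22 Θ ψ ν, HessianForm.hessForm Θ ψ μ f = 0 ↔
      ∃ (a : ℝ) (b : Fin d → ℝ),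
        f =ᵐ[ν] fun p => a + ∑ i, b i * HessianForm.isoCoord Θ ψ p i) ∧
    -- if constants and coordinates are square integrable, they are a basis of the null space
    (∫⁻ p, ENNReal.ofReal (1 + ‖HessianForm.isoCoord Θ ψ p‖ ^ 2) ∂ν < ⊤ →
      ∃ (N : Submodule ℝ (Lp ℝ 2 ν)) (one : Lp ℝ 2 ν) (θ : Fin d → Lp ℝ 2 ν),
        (N : Set (Lp ℝ 2 ν)) = HessianForm.nullSpace Θ ψ ν μ ∧
        (one =ᵐ[ν] fun _ => (1 : ℝ)) ∧
        (∀ i, θ i =ᵐ[ν] fun p => HessianForm.isoCoord Θ ψ p i) ∧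
        N = Submodule.span ℝ (insert one (Set.range θ)) ∧
        Module.finrank ℝ N = d + 1) := by
  have hμ_ae := hμ ▸ hψ.ae_withDensity_riemVolume hΘ_open hρ_meas hρ_pos
  exact theorem1_general hΘ_open hΘ_conn hψ hμ_ae (by rcases hν with rfl | rfl; exacts [rfl, hμ_ae])
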